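/- \textbf{Setting.} Let $t\in\{0,1\}$ be a treatment, $x\in\mathcal X$ a covariate, $u$ an unobserved confounder, $e=(e_a,e_b)$ noise. The true process is $y=f^*_t(B^*)+e_{a,t}$ with a score $B^*=\mathbb B^*(x,u,e_b)\in\mathbb R^n$ and injective measurable $f^*_0,f^*_1:\mathbb R^n\to\mathbb R^d$; for each $s$, the noise $e_{a,s}$ is a zero-mean factorized Gaussian with variances $\sigma_{a,s}^2$, independent of $(x,t,u,e_b)$. The potential outcomes $y(s)=f^*_s(B^*)+e_{a,s}$ are integrable, $y=y(t)$, and $\mu_s(x)=\mathbb E(y(s)\mid x)$. A version $p^*(y\mid x,t)$ of the conditional distribution of $y$ is fixed. The model has parameters $\theta=(f,h,k)$: the prior is $p_\theta(z\mid x,t)=\prod_{i=1}^n\mathcal N(z_i;h_{t,i}(x),k_{t,i}(x))$ with $k_{t,i}(x)>0$, and the decoder is $p_\theta(y\mid z,t)=\prod_{j=1}^d\mathcal N(y_j;f_{t,j}(z),\sigma^2_{a,t,j})$, where each $f_t:\mathbb R^n\to\mathbb R^d$ is injective and differentiable and $h_t,k_t$ are measurable. Its observational distribution is $p_\theta(y\mid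 x,t)=\int p_\theta(y\mid z,t)\,p_\theta(z\mid x,t)\,dz$. The natural parameter of the prior, for the statistics $(z,z^2)$, is $\lambda_t(x)=(h_{t,i}/k_{t,i},\,-1/(2k_{t,i}))_{i}\in\mathbb R^{2n}$, with log-partition function $\alpha_t(x)=\sum_i\big(h_{t,i}^2/(2k_{t,i})+\tfrac12\log(2\pi k_{t,i})\big)$. For points $x_0,\dots,x_{2n}\in\mathcal X$ let $L_t$ be the $2n\times2n$ matrix with columns $\lambda_t(x_j)-\lambda_t(x_0)$, and let $\beta_t\in\mathbb R^{2n}$ be the vector with entries $\alpha_t(x_j)-\alpha_t(x_0)$, $j=1,\dots,2n$. A set $S$ of parameters satisfies \emph{general balancing at} $x_0,\dots,x_{2n}$ if there are one invertible $2n\times 2n$ matrix $C$ and one vector $\delta\in\mathbb R^{2n}$ such that, for every parameter in $S$, $L_0$ is invertible, $L_0^{-1}L_1=C$ and $\beta_0-C^{-T}\beta_1=\delta$. A random vector $B$ is a \emph{B-score} for potential outcomes $(Y(0),Y(1))$ if for each $s$ there is a function $F_s$ with $\mathbb E(Y(s)\mid B,x)=F_s(B)=\mathbb E(Y(s)\mid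 B,t=s)$ almost surely. \textbf{Theorem.} (1) Let $\Theta$ be a family of such parameters, and let $\Theta^{\mathrm{opt}}$ be the set of $\theta\in\Theta$ with $p_\theta(y\mid x,t)=p^*(y\mid x,t)$ for all $(x,t)$. Suppose that some $\theta^*\in\Theta^{\mathrm{opt}}$ has outcome functions $f^*_0,f^*_1$, and that $\Theta^{\mathrm{opt}}$ satisfies general balancing at some points $x_0,\dots,x_{2n}$. Let $\theta'\in\Theta^{\mathrm{opt}}$, and let $q(z\mid x,y,t)$ be an encoder (a Markov kernel) with $q(z\mid x,y,t)=p_{\theta'}(z\mid x,y,t)$. Then: (a) There is one invertible affine map $\mathcal A$, the same for both treatments, of the form $\mathcal A(w)_i=a_iw_{\pi(i)}+b_i$ with $a_i\ne0$ and $\pi$ a permutation, such that $f'_t=f^*_t\circ\mathcal A$ for $t=0,1$. For both treatment values, $q(\cdot\mid x,y,t)$ is the conditional distribution given $(x,y,t)$ of the one random vector $\mathcal A^{-1}(B^*)$. This random vector is a B-score for $(y(0),y(1))$. (b) If $(x,y,t)$ is drawn from the true distribution and then $z\sim q(\cdot\mid x,y,t)$, then $z$ is a B-score for the decoder outcomes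 $f'_s(z)+\varepsilon_s$, $s=0,1$, where $\varepsilon_s\sim\mathcal N(0,\operatorname{diag}\sigma_{a,s}^2)$ is independent of $(x,y,t,z)$. (c) For each $s\in\{0,1\}$, $f'_s(z)$ is integrable and, almost surely, $\mu_s(x)=\mathbb E\big(f'_s(z)\mid x\big)=\mathbb E\Big(\int f'_s(z)\,q(dz\mid x,y,t)\,\Big|\,x\Big)$. (2) Let $\theta,\theta'$ be any two parameters as above (injective differentiable outcome functions, positive prior variances) with $p_\theta(y\mid x,t)=p_{\theta'}(y\mid x,t)$ for all $(x,t)$, and let $x_0,\dots,x_{2n}$ be points at which $L_0$ and $L_1$ of $\theta$ are invertible. Then for each $t$ there is an invertible affine map $\mathcal A_t$, of the form given in (a), with $f'_t=f_t\circ\mathcal A_t$; and $\mathcal A_0=\mathcal A_1$ if and only if $\{\theta,\theta'\}$ satisfies general balancing at $x_0,\dots,x_{2n}$. -/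

import Mathlib

open MeasureTheory ProbabilityTheory
open scoped NNReal

noncomputable section

namespace IntactVAE

/-! ### Factorized Gaussian distributions -/

/-- The factorized Gaussian `∏ i, 𝒩(m i, v i)` on `ℝ^ι` (`v i` is the variance). -/
def factGaussian {ι : Type*} [Fintype ι] (m : ι → ℝ) (v : ι → ℝ≥0) : Measure (ι → ℝ) :=
  Measure.pi fun i => gaussianReal (m i) (v i)

instance {ι : Type*} [Fintype ι] (m : ι → ℝ) (v : ι → ℝ≥0) :
    IsProbabilityMeasure (factGaussian m v) := by
  unfold factGaussian; infer_instance

theorem measurable_factGaussian {ι α : Type*} [Fintype ι] [MeasurableSpace α]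
    {m : α → ι → ℝ} {v : α → ι → ℝ≥0} (hm : Measurable m) (hv : Measurable v) :
    Measurable fun a => factGaussian (m a) (v a) := by
  refine Measurable.measure_of_isPiSystem_of_isProbabilityMeasure
    (S := Set.pi Set.univ '' Set.pi Set.univ fun _ : ι => {s : Set ℝ | MeasurableSet s})
    generateFrom_pi.symm isPiSystem_pi ?_
  rintro _ ⟨s, hs, rfl⟩
  simp only [factGaussian, Measure.pi_pi]
  refine Finset.measurable_prod _ fun i _ => ?_
  have h := measurable_gaussianReal.comp
    (((measurable_pi_apply i).comp hm).prodMk ((measurable_pi_apply i).comp hv))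
  have hsi : MeasurableSet (s i) := hs i (Set.mem_univ i)
  exact (Measure.measurable_coe hsi).comp h

/-! ### The generative model -/

/-- Parameters `θ = (f, λ)` of the generative model, with latent dimension `n` and outcome
dimension `d`: for each treatment value `t`, the outcome function `f t`, and the mean `h t x` and
variance `k t x` of the conditional prior. The outcome noise is not a parameter. -/
structure Params (𝒳 : Type*) [MeasurableSpace 𝒳] (n d : ℕ) where
  f : Bool → (Fin n → ℝ) → (Fin d → ℝ)
  h : Bool → 𝒳 → Fin n → ℝ
  k : Bool → 𝒳 → Fin n → ℝ≥0
  measurable_f : ∀ t, Measurable (f t)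
  measurable_h : ∀ t, Measurable (h t)
  measurable_k : ∀ t, Measurable (k t)

namespace Params

variable {𝒳 : Type*} [MeasurableSpace 𝒳] {n d : ℕ} (θ : Params 𝒳 n d)

/-- The outcome functions are injective and differentiable and the prior is nondegenerate. -/
structure Admissible : Prop where
  injective : ∀ t, Function.Injective (θ.f t)
  differentiable : ∀ t, Differentiable ℝ (θ.f t)
  variance_pos : ∀ t x i, 0 < θ.k t x i

/-- The conditional prior `p_λ(z | x, t) = ∏ i, 𝒩(h_i, k_i)`. -/
def prior (t : Bool) (x : 𝒳) : Measure (Fin n → ℝ) := factGaussian (θ.h t x) (θ.k t x)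

instance (t : Bool) (x : 𝒳) : IsProbabilityMeasure (θ.prior t x) := by
  unfold prior; infer_instance

/-- The decoder `p_f(y | z, t) = ∏ j, 𝒩(f_j, v_j)`, with fixed noise variances `v t`. -/
def decoder (v : Bool → Fin d → ℝ≥0) (t : Bool) : Kernel (Fin n → ℝ) (Fin d → ℝ) where
  toFun z := factGaussian (θ.f t z) (v t)
  measurable' := measurable_factGaussian (θ.measurable_f t) measurable_const

instance (v : Bool → Fin d → ℝ≥0) (t : Bool) : IsMarkovKernel (θ.decoder v t) :=
  ⟨fun z => inferInstanceAs (IsProbabilityMeasure (factGaussian (θ.f t z) (v t)))⟩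

/-- The observational distribution `p_θ(y | x, t) = ∫ p_f(y | z, t) p_λ(z | x, t) dz`. -/
def evidence (v : Bool → Fin d → ℝ≥0) (t : Bool) (x : 𝒳) : Measure (Fin d → ℝ) :=
  (θ.prior t x).bind (θ.decoder v t)

/-- The posterior `p_θ(z | x, y, t)`, for fixed `x` and `t`, as a kernel in `y`. -/
def posteriorKernel (v : Bool → Fin d → ℝ≥0) (t : Bool) (x : 𝒳) :
    Kernel (Fin d → ℝ) (Fin n → ℝ) :=
  posterior (θ.decoder v t) (θ.prior t x)

/-- The natural parameter `λ_t(x) ∈ ℝ^{2n}` of the prior, for the sufficient statistics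
`(z, z²)`: the components are `h_i / k_i` and `-1 / (2 k_i)`. -/
def natParam (t : Bool) (x : 𝒳) : Fin n ⊕ Fin n → ℝ :=
  Sum.elim (fun i => θ.h t x i / θ.k t x i) (fun i => -1 / (2 * (θ.k t x i : ℝ)))

/-- The log-partition function `α_t(x)` of the prior, whose density is
`exp (⟪λ_t(x), (z, z²)⟫ - α_t(x))`. -/
def logPartition (t : Bool) (x : 𝒳) : ℝ :=
  ∑ i, (θ.h t x i ^ 2 / (2 * (θ.k t x i : ℝ)) + Real.log (2 * Real.pi * θ.k t x i) / 2)

/-- The matrix `L_t`: its `2n` columns are `λ_t(x k) - λ_t(x₀)`. -/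
def L (t : Bool) (x₀ : 𝒳) (x : Fin n ⊕ Fin n → 𝒳) :
    Matrix (Fin n ⊕ Fin n) (Fin n ⊕ Fin n) ℝ :=
  Matrix.of fun i k => θ.natParam t (x k) i - θ.natParam t x₀ i

/-- The vector `β_t`, with entries `α_t(x k) - α_t(x₀)`. -/
def β (t : Bool) (x₀ : 𝒳) (x : Fin n ⊕ Fin n → 𝒳) : Fin n ⊕ Fin n → ℝ :=
  fun k => θ.logPartition t (x k) - θ.logPartition t x₀

/-- `L_0⁻¹ L_1 = C` and `β_0 - C⁻ᵀ β_1 = d` at the given points. -/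
structure BalancedAt (x₀ : 𝒳) (x : Fin n ⊕ Fin n → 𝒳)
    (C : Matrix (Fin n ⊕ Fin n) (Fin n ⊕ Fin n) ℝ) (dvec : Fin n ⊕ Fin n → ℝ) : Prop where
  isUnit_L : IsUnit (θ.L false x₀ x)
  L_eq : (θ.L false x₀ x)⁻¹ * θ.L true x₀ x = C
  β_eq : θ.β false x₀ x - Matrix.mulVec (C⁻¹).transpose (θ.β true x₀ x) = dvec

end Params

/-- General balancing of a set of parameters at the given `2n + 1` points: one invertible `C` and
one `d` serve all the parameters in the set. -/
def GeneralBalancing {𝒳 : Type*} [MeasurableSpace 𝒳] {n d : ℕ} (S : Set (Params 𝒳 n d))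
    (x₀ : 𝒳) (x : Fin n ⊕ Fin n → 𝒳) : Prop :=
  ∃ (C : Matrix (Fin n ⊕ Fin n) (Fin n ⊕ Fin n) ℝ) (dvec : Fin n ⊕ Fin n → ℝ),
    IsUnit C ∧ ∀ θ ∈ S, θ.BalancedAt x₀ x C dvec

/-- The parameters in the family `Θ` whose observational distribution is `pstar(y | x, t)`. -/
def optimalParams {𝒳 : Type*} [MeasurableSpace 𝒳] {n d : ℕ} (Θ : Set (Params 𝒳 n d))
    (v : Bool → Fin d → ℝ≥0) (pstar : Kernel (𝒳 × Bool) (Fin d → ℝ)) : Set (Params 𝒳 n d) :=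
  {θ | θ ∈ Θ ∧ ∀ t x, θ.evidence v t x = pstar (x, t)}

/-- The map `w ↦ diag(a) (w ∘ π) + b`, with all `a i ≠ 0`: an affine map that acts coordinatewise,
up to the order of the coordinates. -/
def IsCoordinatewise {n : ℕ} (𝒜 : (Fin n → ℝ) ≃ᵃ[ℝ] (Fin n → ℝ)) : Prop :=
  ∃ (π : Equiv.Perm (Fin n)) (a b : Fin n → ℝ),
    (∀ i, a i ≠ 0) ∧ ∀ w i, 𝒜 w i = a i * w (π i) + b i

/-! ### The true generating process -/

/-- The data generating process: covariate `x`, treatment `t`, unobserved confounder `u`,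
noise `(e_a, e_b)`, score `𝔹(x, u, e_b)`, and outcome `y = f_t(𝔹(x, u, e_b)) + e_{a,t}`. The noise
`e_{a,s}` that comes with the assignment of treatment `s` is a zero-mean factorized Gaussian that
is exogenous, that is, independent of `(x, t, u, e_b)`. -/
structure TrueProcess {Ω : Type*} [MeasurableSpace Ω] (P : Measure Ω) (𝒳 𝒰 ℰ : Type*)
    [MeasurableSpace 𝒳] [MeasurableSpace 𝒰] [MeasurableSpace ℰ] (n d : ℕ) where
  x : Ω → 𝒳
  t : Ω → Bool
  u : Ω → 𝒰
  eb : Ω → ℰ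
  ea : Bool → Ω → (Fin d → ℝ)
  scoreFun : 𝒳 × 𝒰 × ℰ → (Fin n → ℝ)
  f : Bool → (Fin n → ℝ) → (Fin d → ℝ)
  noiseVar : Bool → Fin d → ℝ≥0
  measurable_x : Measurable x
  measurable_t : Measurable t
  measurable_u : Measurable u
  measurable_eb : Measurable eb
  measurable_ea : ∀ s, Measurable (ea s)
  measurable_scoreFun : Measurable scoreFun
  measurable_f : ∀ s, Measurable (f s)
  injective_f : ∀ s, Function.Injective (f s)
  law_ea : ∀ s, P.map (ea s) = factGaussian 0 (noiseVar s)
  indep_ea : ∀ s, IndepFun (ea s) (fun ω => (x ω, t ω, u ω, eb ω)) P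

namespace TrueProcess

variable {Ω : Type*} [MeasurableSpace Ω] {P : Measure Ω} {𝒳 𝒰 ℰ : Type*}
  [MeasurableSpace 𝒳] [MeasurableSpace 𝒰] [MeasurableSpace ℰ] {n d : ℕ}
  (M : TrueProcess P 𝒳 𝒰 ℰ n d)

/-- The true score `𝔹*`, a random variable that is not affected by the treatment assignment. -/
def score (ω : Ω) : Fin n → ℝ := M.scoreFun (M.x ω, M.u ω, M.eb ω)

/-- The potential outcome `y(s)`. -/
def potential (s : Bool) (ω : Ω) : Fin d → ℝ := M.f s (M.score ω) + M.ea s ω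

/-- The factual outcome `y = y(t)`. -/
def y (ω : Ω) : Fin d → ℝ := M.potential (M.t ω) ω

/-- The observation `(x, y, t)`. -/
def obs (ω : Ω) : 𝒳 × (Fin d → ℝ) × Bool := (M.x ω, M.y ω, M.t ω)

/-- The conditional expected potential outcome `μ_s(x) = 𝔼(y(s) | x)`, as a random variable. -/
def μ (s : Bool) : Ω → Fin d → ℝ :=
  condExp (MeasurableSpace.comap M.x inferInstance) P (M.potential s)

end TrueProcess

/-! ### Scores -/

/-- `B` is a B-score for the potential outcomes `Y 0, Y 1`, with covariate `X` and treatment `T`: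
for each `s`, `𝔼(Y s | B, X) = 𝔼(Y s | B, T = s) = F_s(B)` for a function `F_s`. -/
def IsBScore {Ω : Type*} [MeasurableSpace Ω] (P : Measure Ω) {𝒳 : Type*} [MeasurableSpace 𝒳]
    {n d : ℕ} (X : Ω → 𝒳) (T : Ω → Bool) (Y : Bool → Ω → (Fin d → ℝ))
    (B : Ω → (Fin n → ℝ)) : Prop :=
  ∀ s, Integrable (Y s) P ∧ ∃ F : (Fin n → ℝ) → (Fin d → ℝ), Measurable F ∧
    condExp (MeasurableSpace.comap (fun ω => (B ω, X ω)) inferInstance) P (Y s)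
      =ᵐ[P] (fun ω => F (B ω)) ∧
    condExp (MeasurableSpace.comap B inferInstance) (cond P (T ⁻¹' {s})) (Y s)
      =ᵐ[cond P (T ⁻¹' {s})] (fun ω => F (B ω))

/-- An encoder `q(z | x, y, t)` is consistent with `θ` if it is the posterior `p_θ(z | x, y, t)`
(which, as a conditional distribution, is defined for almost every `y`). -/
def EncoderConsistent {𝒳 : Type*} [MeasurableSpace 𝒳] {n d : ℕ} (θ : Params 𝒳 n d)
    (v : Bool → Fin d → ℝ≥0) (q : Kernel (𝒳 × (Fin d → ℝ) × Bool) (Fin n → ℝ)) : Prop :=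
  ∀ t x, ∀ᵐ y ∂(θ.evidence v t x), q (x, y, t) = θ.posteriorKernel v t x y

section Representation

variable {Ω : Type*} [MeasurableSpace Ω] {P : Measure Ω} {𝒳 𝒰 ℰ : Type*}
  [MeasurableSpace 𝒳] [MeasurableSpace 𝒰] [MeasurableSpace ℰ] {n d : ℕ}

/-- The joint law of `((x, y, t), z)`: the observation is drawn from the true distribution, and
the representation `z` from the encoder. -/
def encodedLaw (M : TrueProcess P 𝒳 𝒰 ℰ n d)
    (q : Kernel (𝒳 × (Fin d → ℝ) × Bool) (Fin n → ℝ)) :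
    Measure ((𝒳 × (Fin d → ℝ) × Bool) × (Fin n → ℝ)) :=
  (P.map M.obs).compProd q

/-- The joint law of `((x, y, t), z)` as above and fresh outcome noise `(ε_0, ε_1)`. -/
def encodedNoiseLaw (M : TrueProcess P 𝒳 𝒰 ℰ n d)
    (q : Kernel (𝒳 × (Fin d → ℝ) × Bool) (Fin n → ℝ)) :
    Measure (((𝒳 × (Fin d → ℝ) × Bool) × (Fin n → ℝ)) × (Bool → Fin d → ℝ)) :=
  (encodedLaw M q).prod (Measure.pi fun s => factGaussian 0 (M.noiseVar s))

/-- The encoder's representation `z` is a B-score for the outcomes `f_s(z) + ε_s` which the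
decoder produces from it when treatment `s` is assigned. -/
def EncoderIsBScore (M : TrueProcess P 𝒳 𝒰 ℰ n d) (θ : Params 𝒳 n d)
    (q : Kernel (𝒳 × (Fin d → ℝ) × Bool) (Fin n → ℝ)) : Prop :=
  IsBScore (encodedNoiseLaw M q) (fun p => p.1.1.1) (fun p => p.1.1.2.2)
    (fun s p => θ.f s p.1.2 + p.2 s) (fun p => p.1.2)

end Representation

end IntactVAE

end

noncomputable section

namespace IntactVAE

/-! ### Deconvolution of Gaussian noise -/

/-! The evidence is the image of the prior under the outcome function, convolved with Gaussian
noise. A Gaussian characteristic function has no zeros, so the noise can be removed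
(`conv_factGaussian_injective`): equal evidences mean `f t` and `f' t` push their priors to the same
measure. Identifiability follows by comparing priors at two covariate values. Likelihood ratios
survive injective maps, so whenever `f z = f' w` the log-ratios of the two models agree at `z` and
`w`. These are affine in `(z, z²)` and `(w, w²)`; the `2n` equations with invertible `L_t` solve to
`(z, z²) = M (w, w²) + c`. Since squares of the first half must again be combinations of `w` and
`w²` without cross terms, `w ↦ z` is affine and monomial (`exists_coordinatewise_of_suffStat`). The
relations `L' = Mᵀ L` and `β' = β - Lᵀ c` turn general balancing into `M 0 = M 1` and `c 0 = c 1`,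
that is, into equality of the two affine maps (`identifiability`). With one map `𝒜` for both
treatments, `W = 𝒜⁻¹(B*)` is a single random vector with `f'_s(W) = f*_s(B*)`. Deconvolving once
more, now conditionally on `(x, t)`, shows that the law of `W` given `(x, t)` is the model prior.
Hence `(W, y)` follows the model and the posterior is the law of `W` given `(x, y, t)`
(`TrueProcess.hasCondDistrib_encoder`). No ignorability of `t` given `x` is needed, because the
prior may depend on `t`. The score properties use only that the noise is centred and exogenous, and
consistency is the tower property. -/

theorem charFunDual_factGaussian_ne_zero {ι : Type*} [Fintype ι] (m : ι → ℝ) (v : ι → ℝ≥0)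
    (ℓ : StrongDual ℝ (ι → ℝ)) : charFunDual (factGaussian m v) ℓ ≠ 0 := by
  classical
  rw [factGaussian, charFunDual_pi]
  exact Finset.prod_ne_zero_iff.2 fun i _ => by
    rw [IsGaussian.charFunDual_eq]; exact Complex.exp_ne_zero _

/-- Characteristic functions turn the convolution into a product, and the Gaussian factor can be
cancelled pointwise. Zero variances are harmless. -/
theorem conv_factGaussian_injective {ι : Type*} [Fintype ι] {m : ι → ℝ} {v : ι → ℝ≥0}
    {μ ν : Measure (ι → ℝ)} [IsFiniteMeasure μ] [IsFiniteMeasure ν]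
    (h : μ ∗ factGaussian m v = ν ∗ factGaussian m v) : μ = ν := by
  refine Measure.ext_of_charFunDual (funext fun ℓ => ?_)
  have := congrArg (fun ρ => charFunDual ρ ℓ) h
  simp only [charFunDual_conv] at this
  exact mul_right_cancel₀ (charFunDual_factGaussian_ne_zero m v ℓ) this

theorem factGaussian_zero_map_const_add {ι : Type*} [Fintype ι] (m : ι → ℝ) (v : ι → ℝ≥0) :
    (factGaussian 0 v).map (fun e => m + e) = factGaussian m v := by
  unfold factGaussian
  have := Measure.pi_map_pi (μ := fun i => gaussianReal ((0 : ι → ℝ) i) (v i))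
    (f := fun i e => m i + e) (fun i => by fun_prop)
  simp only [gaussianReal_map_const_add, Pi.zero_apply, zero_add] at this
  exact this

theorem conv_factGaussian_eq_bind {ι α : Type*} [Fintype ι] [MeasurableSpace α] {μ : Measure α}
    [SFinite μ] {g : α → ι → ℝ} (hg : Measurable g) (v : ι → ℝ≥0) :
    μ.map g ∗ factGaussian 0 v = μ.bind fun z => factGaussian (g z) v := by
  have hm : Measurable fun z => factGaussian (g z) v := measurable_factGaussian hg measurable_const
  ext s hs
  have hs' : MeasurableSet ((fun p : (ι → ℝ) × (ι → ℝ) => p.1 + p.2) ⁻¹' s) :=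
    (measurable_fst.add measurable_snd) hs
  rw [Measure.bind_apply hs hm.aemeasurable, Measure.conv, Measure.map_apply (by fun_prop) hs,
    Measure.prod_apply hs', lintegral_map (measurable_measure_prodMk_left hs') hg]
  refine lintegral_congr fun z => ?_
  rw [← factGaussian_zero_map_const_add (g z), Measure.map_apply (by fun_prop) hs]
  rfl

theorem integrable_id_factGaussian {ι : Type*} [Fintype ι] (m : ι → ℝ) (v : ι → ℝ≥0) :
    Integrable (fun e => e) (factGaussian m v) := by
  classical
  refine Integrable.of_eval fun i => ?_
  have : Integrable (fun x : ℝ => x) ((factGaussian m v).map (fun e => e i)) := by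
    rw [factGaussian, Measure.pi_map_eval]
    simp only [measure_univ, Finset.prod_const_one, one_smul]
    exact (memLp_id_gaussianReal 1).integrable le_rfl
  exact this.comp_measurable (measurable_pi_apply i)

theorem integral_id_factGaussian {ι : Type*} [Fintype ι] (m : ι → ℝ) (v : ι → ℝ≥0) :
    ∫ e, e ∂factGaussian m v = m := by
  classical
  ext i
  rw [eval_integral (fun j => (integrable_id_factGaussian m v).eval j)]
  have := integral_map (μ := factGaussian m v) (φ := fun e => e i) (f := fun x : ℝ => x)
    (measurable_pi_apply i).aemeasurable measurable_id.aestronglyMeasurable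
  rw [← this, factGaussian, Measure.pi_map_eval]
  simp [integral_id_gaussianReal]

/-! ### Densities -/

theorem factGaussian_eq_withDensity {ι : Type*} [Fintype ι] (m : ι → ℝ) {v : ι → ℝ≥0}
    (hv : ∀ i, v i ≠ 0) :
    factGaussian m v =
      volume.withDensity fun z => ENNReal.ofReal (∏ i, gaussianPDFReal (m i) (v i) (z i)) := by
  refine Measure.pi_eq fun s hs => ?_
  rw [withDensity_apply _ (MeasurableSet.univ_pi hs), volume_pi, Measure.restrict_pi_pi,
    ← ofReal_integral_eq_lintegral_ofReal, integral_fintype_prod_eq_prod,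
    ENNReal.ofReal_prod_of_nonneg]
  · exact Finset.prod_congr rfl fun i _ => (gaussianReal_apply_eq_integral _ (hv i) _).symm
  · exact fun i _ => integral_nonneg fun _ => gaussianPDFReal_nonneg _ _ _
  · exact Integrable.fintype_prod fun i => (integrable_gaussianPDFReal _ _).restrict
  · exact ae_of_all _ fun z => Finset.prod_nonneg fun i _ => gaussianPDFReal_nonneg _ _ _

/-- Exponentials never vanish, so the second measure has density `exp (g₁ - g₀)` relative to the
first, and an embedding transports this density. The value `0` off the range of `f` later serves to
detect that range. -/
theorem map_withDensity_exp {E F : Type*} [MeasurableSpace E] [MeasurableSpace F] {ρ : Measure E}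
    {f : E → F} (hf : MeasurableEmbedding f) {g₀ g₁ : E → ℝ} (hg₀ : Measurable g₀)
    (hg₁ : Measurable g₁) :
    (ρ.withDensity fun z => ENNReal.ofReal (Real.exp (g₁ z))).map f =
      ((ρ.withDensity fun z => ENNReal.ofReal (Real.exp (g₀ z))).map f).withDensity
        (Function.extend f (fun z => ENNReal.ofReal (Real.exp (g₁ z - g₀ z))) 0) := by
  ext s hs
  have hr : Measurable (Function.extend f
      (fun z => ENNReal.ofReal (Real.exp (g₁ z - g₀ z))) 0) :=
    hf.measurable_extend (by fun_prop) measurable_const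
  rw [withDensity_apply _ hs, setLIntegral_map hs hr hf.measurable, Measure.map_apply
    hf.measurable hs, withDensity_apply _ (hf.measurable hs)]
  simp only [hf.injective.extend_apply]
  rw [setLIntegral_withDensity_eq_setLIntegral_mul _ (by fun_prop) (by fun_prop)
    (hf.measurable hs)]
  refine lintegral_congr fun z => ?_
  rw [Pi.mul_apply, ← ENNReal.ofReal_mul (Real.exp_nonneg _), ← Real.exp_add]
  simp

/-- Two pairs of measures with positive densities which have the same images under injective maps
have the same log-likelihood ratios at corresponding points. -/
theorem ae_exists_eq_and_logRatio_eq {E E' F : Type*} [MeasurableSpace E] [MeasurableSpace E']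
    [MeasurableSpace F] {ρ : Measure E} {ρ' : Measure E'} {f : E → F} {f' : E' → F}
    (hf : MeasurableEmbedding f) (hf' : MeasurableEmbedding f') {g₀ g₁ : E → ℝ} {g₀' g₁' : E' → ℝ}
    (hg₀ : Measurable g₀) (hg₁ : Measurable g₁) (hg₀' : Measurable g₀') (hg₁' : Measurable g₁')
    [IsFiniteMeasure (ρ.withDensity fun z => ENNReal.ofReal (Real.exp (g₀ z)))]
    (h₀ : (ρ.withDensity fun z => ENNReal.ofReal (Real.exp (g₀ z))).map f =
      (ρ'.withDensity fun w => ENNReal.ofReal (Real.exp (g₀' w))).map f')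
    (h₁ : (ρ.withDensity fun z => ENNReal.ofReal (Real.exp (g₁ z))).map f =
      (ρ'.withDensity fun w => ENNReal.ofReal (Real.exp (g₁' w))).map f') :
    ∀ᵐ w ∂ρ', ∃ z, f z = f' w ∧ g₁ z - g₀ z = g₁' w - g₀' w := by
  rw [map_withDensity_exp hf hg₀ hg₁, map_withDensity_exp hf' hg₀' hg₁', ← h₀] at h₁
  have hr := hf.measurable_extend (g := fun z => ENNReal.ofReal (Real.exp (g₁ z - g₀ z)))
    (g' := 0) (by fun_prop) measurable_const
  have hr' := hf'.measurable_extend (g := fun z => ENNReal.ofReal (Real.exp (g₁' z - g₀' z)))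
    (g' := 0) (by fun_prop) measurable_const
  rw [withDensity_eq_iff_of_sigmaFinite hr.aemeasurable hr'.aemeasurable, h₀] at h₁
  have h₂ := ae_of_ae_map hf'.measurable.aemeasurable h₁
  -- The base density is positive everywhere, so almost everywhere for the weighted measure is
  -- almost everywhere for `ρ'`.
  rw [ae_withDensity_iff (by fun_prop)] at h₂
  filter_upwards [h₂] with w hw
  have hw := hw (by simp [Real.exp_pos])
  rw [hf'.injective.extend_apply] at hw
  by_cases hz : ∃ z, f z = f' w
  · obtain ⟨z, hz⟩ := hz
    refine ⟨z, hz, ?_⟩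
    rw [← hz, hf.injective.extend_apply,
      ENNReal.ofReal_eq_ofReal_iff (Real.exp_nonneg _) (Real.exp_nonneg _)] at hw
    exact Real.exp_injective hw
  -- Outside the range of `f` the ratio on one side is `0`, while the other is an exponential.
  · rw [Function.extend_apply' _ _ _ hz] at hw
    exact absurd hw.symm (by simp [Real.exp_pos])

/-! ### Quadratic statistics -/

open Matrix

/-- The sufficient statistics `(z, z²)` of the factorized Gaussian family. -/
def suffStat {n : ℕ} (z : Fin n → ℝ) : Fin n ⊕ Fin n → ℝ :=
  Sum.elim z fun i => z i ^ 2

theorem continuous_suffStat {n : ℕ} : Continuous (suffStat : (Fin n → ℝ) → _) := by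
  refine continuous_pi fun i => ?_
  rcases i with i | i <;> simp only [suffStat, Sum.elim_inl, Sum.elim_inr] <;> fun_prop

theorem suffStat_injective {n : ℕ} :
    Function.Injective (suffStat : (Fin n → ℝ) → _) := fun _ _ h =>
  funext fun i => congrFun h (Sum.inl i)

theorem suffStat_zero {n : ℕ} : suffStat (0 : Fin n → ℝ) = 0 := by
  ext i; rcases i with i | i <;> simp [suffStat]

theorem suffStat_single {n : ℕ} (k : Fin n) (s : ℝ) :
    suffStat (Pi.single k s) = Pi.single (Sum.inl k) s + Pi.single (Sum.inr k) (s ^ 2) := by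
  ext i
  rcases i with i | i <;> by_cases h : i = k <;> simp [suffStat, Pi.single_apply, h]

theorem suffStat_add_of_disjoint {n : ℕ} {j k : Fin n} (hjk : j ≠ k) (s r : ℝ) :
    suffStat (Pi.single j s + Pi.single k r) =
      suffStat (Pi.single j s) + suffStat (Pi.single k r) := by
  ext i
  rcases i with i | i
  · simp [suffStat]
  · by_cases hj : i = j
    · subst hj; simp [suffStat, hjk]
    · simp [suffStat, hj]

theorem mulVec_suffStat_single {n : ℕ} {m : Type*} [Fintype m]
    (M : Matrix m (Fin n ⊕ Fin n) ℝ) (k : Fin n) (s : ℝ) (i : m) :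
    (M *ᵥ suffStat (Pi.single k s)) i = M i (Sum.inl k) * s + M i (Sum.inr k) * s ^ 2 := by
  rw [suffStat_single, mulVec_add]
  simp [mulVec_single, mul_comm]

/-- The sufficient statistics, together with the constant `1`, are linearly independent. -/
theorem eq_of_mulVec_suffStat_add {n : ℕ} {m : Type*} [Fintype m]
    {M M' : Matrix m (Fin n ⊕ Fin n) ℝ} {c c' : m → ℝ}
    (h : ∀ w, M *ᵥ suffStat w + c = M' *ᵥ suffStat w + c') : M = M' ∧ c = c' := by
  have hc : c = c' := by simpa [suffStat_zero] using h 0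
  subst hc
  refine ⟨?_, rfl⟩
  ext i k
  rcases k with k | k
  all_goals
    -- The values at `±1` on an axis separate the odd coefficient from the even one.
    have h₁ := congrFun (h (Pi.single k 1)) i
    have h₂ := congrFun (h (Pi.single k (-1))) i
    simp only [Pi.add_apply, mulVec_suffStat_single] at h₁ h₂
    linarith

/-- The fourth difference over `-2, …, 2` kills the left side and equals `24 b²` on the right. -/
theorem quadratic_coeff_eq_zero {a b c a' b' c' : ℝ}
    (h : ∀ s : ℝ, a' * s + b' * s ^ 2 + c' = (a * s + b * s ^ 2 + c) ^ 2) : b = 0 := by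
  have h0 := h 0
  have h1 := h 1
  have h2 := h (-1)
  have h3 := h 2
  have h4 := h (-2)
  have : b ^ 2 = 0 := by ring_nf at *; linarith
  exact pow_eq_zero_iff two_ne_zero |>.1 this

/-- The invertible affine map `w ↦ diag(a) (w ∘ π) + b`. -/
def coordinatewiseEquiv {n : ℕ} (π : Equiv.Perm (Fin n)) (a b : Fin n → ℝ) (ha : ∀ i, a i ≠ 0) :
    (Fin n → ℝ) ≃ᵃ[ℝ] (Fin n → ℝ) :=
  ((LinearEquiv.funCongrLeft ℝ ℝ π).trans
    (LinearEquiv.piCongrRight fun i => LinearEquiv.smulOfNeZero ℝ ℝ (a i) (ha i))).toAffineEquiv.trans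
    (AffineEquiv.constVAdd ℝ _ b)

theorem coordinatewiseEquiv_apply {n : ℕ} (π : Equiv.Perm (Fin n)) (a b : Fin n → ℝ)
    (ha : ∀ i, a i ≠ 0) (w : Fin n → ℝ) (i : Fin n) :
    coordinatewiseEquiv π a b ha w i = a i * w (π i) + b i := by
  simp [coordinatewiseEquiv, LinearEquiv.funCongrLeft_apply, add_comm]

/-- An injective map whose sufficient statistics are an affine function of those of its argument
acts coordinatewise. -/
theorem exists_coordinatewise_of_suffStat {n : ℕ}
    {M : Matrix (Fin n ⊕ Fin n) (Fin n ⊕ Fin n) ℝ} {c : Fin n ⊕ Fin n → ℝ}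
    {q : (Fin n → ℝ) → (Fin n → ℝ)} (hq : Function.Injective q)
    (h : ∀ w, suffStat (q w) = M *ᵥ suffStat w + c) :
    ∃ 𝒜 : (Fin n → ℝ) ≃ᵃ[ℝ] (Fin n → ℝ), IsCoordinatewise 𝒜 ∧ ∀ w, 𝒜 w = q w := by
  have hq₁ : ∀ w i, q w i = (M *ᵥ suffStat w) (Sum.inl i) + c (Sum.inl i) := fun w i =>
    congrFun (h w) (Sum.inl i)
  have hq₂ : ∀ w i, q w i ^ 2 = (M *ᵥ suffStat w) (Sum.inr i) + c (Sum.inr i) := fun w i =>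
    congrFun (h w) (Sum.inr i)
  -- Along an axis, `q i` and its square are both polynomials of degree at most two, so `q` is
  -- affine there.
  have hB : ∀ i k, M (Sum.inl i) (Sum.inr k) = 0 := fun i k =>
    quadratic_coeff_eq_zero fun s => by
      have := hq₂ (Pi.single k s) i
      rw [hq₁, mulVec_suffStat_single, mulVec_suffStat_single] at this
      exact this.symm
  set A : Matrix (Fin n) (Fin n) ℝ := M.toBlocks₁₁ with hA
  have hlin : ∀ w i, q w i = ∑ k, A i k * w k + c (Sum.inl i) := fun w i => by
    rw [hq₁]
    simp [mulVec, dotProduct, Fintype.sum_sum_type, hB, suffStat, hA, toBlocks₁₁]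
  -- The mixed second difference of `(q i)²` is `2 A i j A i k`, and it vanishes because the
  -- statistics contain no cross terms. Each row of `A` thus has at most one nonzero entry;
  -- injectivity of `q` puts one in each column.
  have hrow : ∀ i j k, j ≠ k → A i j * A i k = 0 := fun i j k hjk => by
    have h₀ := hq₂ 0 i
    have h₁ := hq₂ (Pi.single j 1) i
    have h₂ := hq₂ (Pi.single k 1) i
    have h₃ := hq₂ (Pi.single j 1 + Pi.single k 1) i
    rw [suffStat_add_of_disjoint hjk, mulVec_add, Pi.add_apply] at h₃
    rw [suffStat_zero, mulVec_zero, Pi.zero_apply] at h₀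
    simp only [hlin, Pi.add_apply, Pi.zero_apply, mul_add, Finset.sum_add_distrib, Pi.single_apply,
      mul_ite, mul_one, mul_zero, Finset.sum_ite_eq', Finset.sum_const_zero, Finset.mem_univ,
      if_true] at h₀ h₁ h₂ h₃
    nlinarith
  have hcol : ∀ k, ∃ i, A i k ≠ 0 := fun k => by
    by_contra! hk
    have : q (Pi.single k 1) = q 0 := funext fun i => by
      simp [hlin, Pi.single_apply, hk]
    simpa using congrFun (hq this) k
  choose σ hσ using hcol
  have hσi : Function.Injective σ := fun j k hjk => by
    by_contra hne
    exact (mul_ne_zero (hσ j) (hjk ▸ hσ k)) (hrow (σ j) j k hne)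
  let σe := Equiv.ofBijective σ (Finite.injective_iff_bijective.1 hσi)
  have hπ : ∀ i, σ (σe.symm i) = i := fun i => σe.apply_symm_apply i
  have hne : ∀ i, A i (σe.symm i) ≠ 0 := fun i => by
    have := hσ (σe.symm i); rwa [hπ] at this
  refine ⟨coordinatewiseEquiv σe.symm (fun i => A i (σe.symm i)) (fun i => c (Sum.inl i)) hne,
    ⟨_, _, _, hne, coordinatewiseEquiv_apply _ _ _ hne⟩, fun w => funext fun i => ?_⟩
  rw [coordinatewiseEquiv_apply, hlin, Finset.sum_eq_single (σe.symm i)]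
  · intro k _ hk
    rw [(mul_eq_zero.1 (hrow i k _ hk)).resolve_right (hne i), zero_mul]
  · simp

/-! ### Identifiability -/

/-- An affine action on the sufficient statistics which comes from a surjection is invertible. -/
theorem isUnit_transpose_of_suffStat {n : ℕ} {M : Matrix (Fin n ⊕ Fin n) (Fin n ⊕ Fin n) ℝ}
    {c : Fin n ⊕ Fin n → ℝ} {q : (Fin n → ℝ) → (Fin n → ℝ)} (hq : Function.Surjective q)
    (h : ∀ w, suffStat (q w) = M *ᵥ suffStat w + c) : IsUnit Mᵀ := by
  refine mulVec_injective_iff_isUnit.1 ((injective_iff_map_eq_zero Mᵀ.mulVecLin).2 fun v hv => ?_)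
  have hv : v ᵥ* M = 0 := by simpa [mulVec_transpose] using hv
  -- A left null vector `v` of `M` makes `v ⬝ᵥ suffStat (q w)` constant in `w`, hence `v ⬝ᵥ
  -- suffStat` constant by surjectivity.
  have := (eq_of_mulVec_suffStat_add (M := replicateRow Unit v) (M' := 0) (c := 0)
    (c' := fun _ => v ⬝ᵥ c) fun z => ?_).1
  · exact funext fun i => congrFun (congrFun this ()) i
  · obtain ⟨w, rfl⟩ := hq z
    ext
    rw [h, add_zero, zero_mulVec, zero_add]
    simp [mulVec, replicateRow, dotProduct_add, dotProduct_mulVec, hv]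

namespace Params

variable {𝒳 : Type*} [MeasurableSpace 𝒳] {n d : ℕ} (θ : Params 𝒳 n d)

/-- The logarithm of the density of the prior. -/
def logPrior (t : Bool) (x : 𝒳) (z : Fin n → ℝ) : ℝ :=
  θ.natParam t x ⬝ᵥ suffStat z - θ.logPartition t x

theorem measurable_logPrior (t : Bool) (x : 𝒳) : Measurable (θ.logPrior t x) := by
  have := (continuous_suffStat (n := n))
  unfold logPrior dotProduct
  exact Continuous.measurable (by fun_prop)

end Params

theorem gaussianPDFReal_eq_exp (m : ℝ) {v : ℝ≥0} (hv : 0 < v) (z : ℝ) :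
    gaussianPDFReal m v z =
      Real.exp (m / v * z + -1 / (2 * v) * z ^ 2 -
        (m ^ 2 / (2 * v) + Real.log (2 * Real.pi * v) / 2)) := by
  have hv' : (0 : ℝ) < v := hv
  have hpos : 0 < 2 * Real.pi * v := by positivity
  rw [gaussianPDFReal, Real.sqrt_eq_rpow, Real.rpow_def_of_pos hpos, ← Real.exp_neg, ← Real.exp_add]
  congr 1
  field_simp
  ring

namespace Params

variable {𝒳 : Type*} [MeasurableSpace 𝒳] {n d : ℕ} (θ : Params 𝒳 n d)

theorem prior_eq_withDensity (t : Bool) (x : 𝒳) (hk : ∀ i, 0 < θ.k t x i) :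
    θ.prior t x =
      volume.withDensity fun z => ENNReal.ofReal (Real.exp (θ.logPrior t x z)) := by
  rw [prior, factGaussian_eq_withDensity _ fun i => (hk i).ne']
  congr with z
  simp only [gaussianPDFReal_eq_exp _ (hk _)]
  rw [← Real.exp_sum, logPrior, logPartition, dotProduct, Fintype.sum_sum_type,
    ← Finset.sum_add_distrib, ← Finset.sum_sub_distrib]
  rfl

theorem evidence_eq_conv (v : Bool → Fin d → ℝ≥0) (t : Bool) (x : 𝒳) :
    θ.evidence v t x = (θ.prior t x).map (θ.f t) ∗ factGaussian 0 (v t) :=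
  (conv_factGaussian_eq_bind (θ.measurable_f t) (v t)).symm

variable {θ} {θ' : Params 𝒳 n d}

theorem map_prior_eq {v : Bool → Fin d → ℝ≥0} {t : Bool} {x : 𝒳}
    (h : θ.evidence v t x = θ'.evidence v t x) :
    (θ.prior t x).map (θ.f t) = (θ'.prior t x).map (θ'.f t) := by
  rw [evidence_eq_conv, evidence_eq_conv] at h
  exact conv_factGaussian_injective h

theorem Admissible.measurableEmbedding (hθ : θ.Admissible) (t : Bool) :
    MeasurableEmbedding (θ.f t) :=
  (θ.measurable_f t).measurableEmbedding (hθ.injective t)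

/-- Two admissible parameters with the same evidence are related by a coordinatewise affine map of
the latent space, whose action on the sufficient statistics also relates the natural parameters
and the log-partition functions. -/
theorem exists_coordinatewise (hθ : θ.Admissible) (hθ' : θ'.Admissible)
    {v : Bool → Fin d → ℝ≥0} {t : Bool} (h : ∀ x, θ.evidence v t x = θ'.evidence v t x)
    {x₀ : 𝒳} {x : Fin n ⊕ Fin n → 𝒳} (hL : IsUnit (θ.L t x₀ x)) :
    ∃ (𝒜 : (Fin n → ℝ) ≃ᵃ[ℝ] (Fin n → ℝ)) (M : Matrix (Fin n ⊕ Fin n) (Fin n ⊕ Fin n) ℝ)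
      (c : Fin n ⊕ Fin n → ℝ), IsCoordinatewise 𝒜 ∧ θ'.f t = θ.f t ∘ 𝒜 ∧
      (∀ w, suffStat (𝒜 w) = M *ᵥ suffStat w + c) ∧
      θ'.L t x₀ x = Mᵀ * θ.L t x₀ x ∧ θ'.β t x₀ x = θ.β t x₀ x - (θ.L t x₀ x)ᵀ *ᵥ c := by
  set L := θ.L t x₀ x with hLdef
  set L' := θ'.L t x₀ x with hLdef'
  have hLT : IsUnit Lᵀ.det := by rw [det_transpose]; exact (isUnit_iff_isUnit_det _).1 hL
  set M := (Lᵀ)⁻¹ * L'ᵀ with hM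
  set c := (Lᵀ)⁻¹ *ᵥ (θ.β t x₀ x - θ'.β t x₀ x) with hc
  have hLM : Lᵀ * M = L'ᵀ := by rw [hM, ← Matrix.mul_assoc, mul_nonsing_inv _ hLT, Matrix.one_mul]
  have hLc : Lᵀ *ᵥ c = θ.β t x₀ x - θ'.β t x₀ x := by
    rw [hc, mulVec_mulVec, mul_nonsing_inv _ hLT, one_mulVec]
  -- The extra index `none` compares `x₀` with itself; it supplies the point `z` even when `n = 0`.
  -- Injectivity of `θ.f t` makes `z` the same for all indices.
  have hcorr : ∀ᵐ w ∂(volume : Measure (Fin n → ℝ)), ∀ o : Option (Fin n ⊕ Fin n),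
      ∃ z, θ.f t z = θ'.f t w ∧ θ.logPrior t (o.elim x₀ x) z - θ.logPrior t x₀ z =
        θ'.logPrior t (o.elim x₀ x) w - θ'.logPrior t x₀ w := by
    refine ae_all_iff.2 fun o => ?_
    have e := fun y => θ.prior_eq_withDensity t y (hθ.variance_pos t y)
    have e' := fun y => θ'.prior_eq_withDensity t y (hθ'.variance_pos t y)
    have : IsFiniteMeasure ((volume : Measure (Fin n → ℝ)).withDensity fun z =>
        ENNReal.ofReal (Real.exp (θ.logPrior t x₀ z))) := by
      rw [← e]; infer_instance
    refine ae_exists_eq_and_logRatio_eq (ρ := volume) (ρ' := volume) (hθ.measurableEmbedding t)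
      (hθ'.measurableEmbedding t)
      (θ.measurable_logPrior t x₀) (θ.measurable_logPrior t (o.elim x₀ x))
      (θ'.measurable_logPrior t x₀) (θ'.measurable_logPrior t (o.elim x₀ x)) ?_ ?_
    · rw [← e, ← e']; exact map_prior_eq (h x₀)
    · rw [← e, ← e']; exact map_prior_eq (h (o.elim x₀ x))
  have hratio : ∀ (η : Params 𝒳 n d) (j) (z : Fin n → ℝ),
      η.logPrior t (x j) z - η.logPrior t x₀ z =
        ((η.L t x₀ x)ᵀ *ᵥ suffStat z - η.β t x₀ x) j := fun η j z => by
    simp only [logPrior, β, Pi.sub_apply, mulVec, Params.L, transpose_apply, of_apply, dotProduct,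
      sub_mul, Finset.sum_sub_distrib]
    ring
  let Q : (Fin n → ℝ) → Fin n ⊕ Fin n → ℝ := fun w => M *ᵥ suffStat w + c
  let q : (Fin n → ℝ) → Fin n → ℝ := fun w i => Q w (Sum.inl i)
  have hQc : Continuous Q :=
    (Continuous.matrix_mulVec continuous_const continuous_suffStat).add continuous_const
  have hqc : Continuous q := continuous_pi fun i => (continuous_apply _).comp hQc
  have hae : ∀ᵐ w ∂(volume : Measure (Fin n → ℝ)),
      (suffStat (q w), θ'.f t w) = (Q w, θ.f t (q w)) := by
    filter_upwards [hcorr] with w hcw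
    obtain ⟨z, hz, -⟩ := hcw none
    have hw : ∀ j, θ.logPrior t (x j) z - θ.logPrior t x₀ z =
        θ'.logPrior t (x j) w - θ'.logPrior t x₀ w := fun j => by
      obtain ⟨z', hz', h'⟩ := hcw (some j)
      rwa [hθ.injective t (hz'.trans hz.symm)] at h'
    have hT : Lᵀ *ᵥ suffStat z = Lᵀ *ᵥ Q w := by
      have : Lᵀ *ᵥ suffStat z - θ.β t x₀ x = L'ᵀ *ᵥ suffStat w - θ'.β t x₀ x :=
        funext fun j => by rw [← hratio, ← hratio]; exact hw j
      simp only [Q]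
      rw [mulVec_add, mulVec_mulVec, hLM, hLc, sub_eq_iff_eq_add.1 this]
      abel
    have hzQ : suffStat z = Q w :=
      mulVec_injective_iff_isUnit.2 ((isUnit_iff_isUnit_det _).2 hLT) hT
    have hzq : z = q w := funext fun i => congrFun hzQ (Sum.inl i)
    rw [← hzq, hzQ, hz]
  -- Both sides are continuous and Lebesgue measure charges every nonempty open set, so the almost
  -- sure identities hold everywhere. Of differentiability only continuity is used.
  have hall := (Continuous.ae_eq_iff_eq volume
    ((continuous_suffStat.comp hqc).prodMk (hθ'.differentiable t).continuous)
    (hQc.prodMk ((hθ.differentiable t).continuous.comp hqc))).1 hae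
  have hfq : ∀ w, θ'.f t w = θ.f t (q w) := fun w => congrArg Prod.snd (congrFun hall w)
  have hQq : ∀ w, suffStat (q w) = M *ᵥ suffStat w + c := fun w =>
    congrArg Prod.fst (congrFun hall w)
  have hqi : Function.Injective q := fun a b hab =>
    hθ'.injective t (by rw [hfq, hfq, hab])
  obtain ⟨𝒜, h𝒜, hq⟩ := exists_coordinatewise_of_suffStat hqi hQq
  refine ⟨𝒜, M, c, h𝒜, funext fun w => ?_, fun w => ?_, ?_, ?_⟩
  · rw [Function.comp_apply, hq, hfq]
  · rw [hq, hQq]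
  · rw [← transpose_transpose L', ← hLM, transpose_mul, transpose_transpose]
  · rw [hLc, sub_sub_cancel]

end Params

/-- Two admissible parameters with the same evidence are related by a coordinatewise affine map for
each treatment, and the two maps agree exactly under general balancing. -/
theorem identifiability {𝒳 : Type*} [MeasurableSpace 𝒳] {n d : ℕ} {v : Bool → Fin d → ℝ≥0}
    (θ θ' : Params 𝒳 n d) (hθ : θ.Admissible) (hθ' : θ'.Admissible)
    (h : ∀ t x, θ.evidence v t x = θ'.evidence v t x) (x₀ : 𝒳) (x : Fin n ⊕ Fin n → 𝒳)
    (hL : ∀ t, IsUnit (θ.L t x₀ x)) :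
    ∃ 𝒜 : Bool → ((Fin n → ℝ) ≃ᵃ[ℝ] (Fin n → ℝ)),
      (∀ t, IsCoordinatewise (𝒜 t) ∧ θ'.f t = θ.f t ∘ 𝒜 t) ∧
      (GeneralBalancing {θ, θ'} x₀ x ↔ 𝒜 false = 𝒜 true) := by
  choose 𝒜 M c hco hf hM hL' hβ' using fun t =>
    Params.exists_coordinatewise hθ hθ' (h t) (hL t)
  refine ⟨𝒜, fun t => ⟨hco t, hf t⟩, ?_⟩
  have hdet : ∀ t, IsUnit (θ.L t x₀ x).det := fun t => (isUnit_iff_isUnit_det _).1 (hL t)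
  set C := (θ.L false x₀ x)⁻¹ * θ.L true x₀ x with hC
  have hCu : IsUnit C := by
    rw [isUnit_iff_isUnit_det, hC, det_mul]
    exact ((isUnit_nonsing_inv_det _ (hdet false))).mul (hdet true)
  have hLC : θ.L false x₀ x * C = θ.L true x₀ x := by
    rw [hC, ← Matrix.mul_assoc, mul_nonsing_inv _ (hdet false), Matrix.one_mul]
  -- This identity turns the `c true` term of the balanced vector into `L_0ᵀ c true`, comparable
  -- with `L_0ᵀ c false`.
  have hCL : (C⁻¹)ᵀ * (θ.L true x₀ x)ᵀ = (θ.L false x₀ x)ᵀ := by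
    rw [← transpose_mul, ← hLC, Matrix.mul_assoc,
      mul_nonsing_inv _ ((isUnit_iff_isUnit_det _).1 hCu), Matrix.mul_one]
  constructor
  · rintro ⟨C', δ, hC', hS⟩
    have h₁ := hS θ (by simp)
    have h₂ := hS θ' (by simp)
    have hCC : C' = C := h₁.L_eq.symm
    subst C'
    have hLC' : θ'.L false x₀ x * C = θ'.L true x₀ x := by
      rw [← h₂.L_eq, ← Matrix.mul_assoc,
        mul_nonsing_inv _ ((isUnit_iff_isUnit_det _).1 h₂.isUnit_L), Matrix.one_mul]
    have hMM : M false = M true := by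
      rw [hL', hL', Matrix.mul_assoc, hLC] at hLC'
      exact transpose_injective ((hL true).mul_left_injective hLC')
    have hcc : c false = c true := by
      have := h₁.β_eq.trans h₂.β_eq.symm
      rw [hβ', hβ', mulVec_sub, mulVec_mulVec, hCL] at this
      have : (θ.L false x₀ x)ᵀ *ᵥ c false = (θ.L false x₀ x)ᵀ *ᵥ c true := by
        ext i
        have := congrFun this i
        simp only [Pi.sub_apply] at this
        linarith
      exact mulVec_injective_iff_isUnit.2
        ((isUnit_iff_isUnit_det _).2 (by rw [det_transpose]; exact hdet false)) this
    exact AffineEquiv.ext fun w => suffStat_injective (by rw [hM, hM, hMM, hcc])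
  · intro h𝒜
    obtain ⟨hMM, hcc⟩ := eq_of_mulVec_suffStat_add (M := M false) (M' := M true) (c := c false)
      (c' := c true) fun w => by rw [← hM, ← hM, h𝒜]
    have hMu : IsUnit (M true)ᵀ.det :=
      (isUnit_iff_isUnit_det _).1 (isUnit_transpose_of_suffStat (𝒜 true).surjective (hM true))
    refine ⟨C, θ.β false x₀ x - (C⁻¹)ᵀ *ᵥ θ.β true x₀ x, hCu, ?_⟩
    have hθb : θ.BalancedAt x₀ x C (θ.β false x₀ x - (C⁻¹)ᵀ *ᵥ θ.β true x₀ x) :=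
      ⟨hL false, rfl, rfl⟩
    rintro η (rfl | rfl)
    · exact hθb
    · refine ⟨?_, ?_, ?_⟩
      · rw [hL', isUnit_iff_isUnit_det, det_mul, hMM]
        exact hMu.mul (hdet false)
      · rw [hL', hL', hMM, Matrix.mul_inv_rev, Matrix.mul_assoc, ← Matrix.mul_assoc _ _ (θ.L true x₀ x),
          nonsing_inv_mul _ hMu, Matrix.one_mul]
      · rw [hβ', hβ', mulVec_sub, mulVec_mulVec, hCL, hcc]
        abel

/-! ### Conditional distributions of noisy outcomes -/

theorem hasCondDistrib_congr_kernel {Ω α β : Type*} [MeasurableSpace Ω] [MeasurableSpace α]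
    [MeasurableSpace β] {P : Measure Ω} {X : Ω → α} {Y : Ω → β} {κ η : Kernel α β}
    [SFinite P] [IsSFiniteKernel κ] [IsSFiniteKernel η]
    (h : HasCondDistrib Y X κ P) (hκη : κ =ᵐ[P.map X] η) : HasCondDistrib Y X η P :=
  ⟨h.aemeasurable, by rw [h.map_eq, Measure.compProd_congr hκη]⟩

theorem hasCondDistrib_ae_unique {Ω α β : Type*} [MeasurableSpace Ω] [MeasurableSpace α]
    [MeasurableSpace β] [MeasurableSpace.CountablyGenerated β] {P : Measure Ω} [IsFiniteMeasure P]
    {X : Ω → α} {Y : Ω → β} {κ η : Kernel α β} [IsFiniteKernel κ] [IsFiniteKernel η]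
    (h : HasCondDistrib Y X κ P) (h' : HasCondDistrib Y X η P) : κ =ᵐ[P.map X] η :=
  Kernel.ae_eq_of_compProd_eq (h.map_eq.symm.trans h'.map_eq)

/-- The factorized Gaussian with mean `g s b` and variance `v s`, as a kernel in `((x, s), b)`. -/
def noiseKernel {𝒳 β ι : Type*} [MeasurableSpace 𝒳] [MeasurableSpace β] [Fintype ι]
    (g : Bool → β → ι → ℝ) (hg : ∀ s, Measurable (g s)) (v : Bool → ι → ℝ≥0) :
    Kernel ((𝒳 × Bool) × β) (ι → ℝ) where
  toFun p := factGaussian (g p.1.2 p.2) (v p.1.2)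
  measurable' := by
    have h : Measurable fun p : Bool × β => g p.1 p.2 :=
      measurable_from_prod_countable_right hg
    exact measurable_factGaussian
      (h.comp (f := fun p : (𝒳 × Bool) × β => (p.1.2, p.2)) (by fun_prop))
      ((measurable_of_countable v).comp (by fun_prop))

instance {𝒳 β ι : Type*} [MeasurableSpace 𝒳] [MeasurableSpace β] [Fintype ι]
    (g : Bool → β → ι → ℝ) (hg : ∀ s, Measurable (g s)) (v : Bool → ι → ℝ≥0) :
    IsMarkovKernel (noiseKernel (𝒳 := 𝒳) g hg v) :=
  ⟨fun p => inferInstanceAs (IsProbabilityMeasure (factGaussian (g p.1.2 p.2) (v p.1.2)))⟩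

/-- Independence makes the law of `(Z, e)` a product; the shear `(z, e) ↦ (z, g z + e)` and Fubini
give the rest. -/
theorem map_prod_add_noise {Ω α ι : Type*} [MeasurableSpace Ω] [MeasurableSpace α] [Fintype ι]
    {P : Measure Ω} [IsFiniteMeasure P] {Z : Ω → α} {e : Ω → ι → ℝ} {g : α → ι → ℝ} {v : ι → ℝ≥0}
    (hZ : Measurable Z) (he : Measurable e) (hg : Measurable g)
    (hlaw : P.map e = factGaussian 0 v) (hind : IndepFun e Z P)
    {S : Set (α × (ι → ℝ))} (hS : MeasurableSet S) :
    P.map (fun ω => (Z ω, g (Z ω) + e ω)) S =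
      ∫⁻ z, factGaussian (g z) v (Prod.mk z ⁻¹' S) ∂P.map Z := by
  have hprod : P.map (fun ω => (Z ω, e ω)) = (P.map Z).prod (factGaussian 0 v) := by
    rw [(indepFun_iff_map_prod_eq_prod_map_map hZ.aemeasurable he.aemeasurable).1 hind.symm, hlaw]
  have hφ : Measurable fun p : α × (ι → ℝ) => (p.1, g p.1 + p.2) := by fun_prop
  have : P.map (fun ω => (Z ω, g (Z ω) + e ω)) =
      (P.map fun ω => (Z ω, e ω)).map fun p => (p.1, g p.1 + p.2) :=
    (Measure.map_map hφ (hZ.prodMk he)).symm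
  rw [this, hprod, Measure.map_apply hφ hS, Measure.prod_apply (hφ hS)]
  refine lintegral_congr fun z => ?_
  rw [← factGaussian_zero_map_const_add (g z),
    Measure.map_apply (by fun_prop) (measurable_prodMk_left hS)]
  rfl

/-- If every potential outcome is a function of `B` plus independent Gaussian noise, then the
factual outcome has the corresponding Gaussian conditional distribution given `(X, T, B)`. -/
theorem hasCondDistrib_factual {Ω 𝒳 β ι : Type*} [MeasurableSpace Ω] [MeasurableSpace 𝒳]
    [MeasurableSpace β] [Fintype ι] {P : Measure Ω} [IsFiniteMeasure P] {X : Ω → 𝒳} {T : Ω → Bool}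
    {B : Ω → β} {e : Bool → Ω → ι → ℝ} {g : Bool → β → ι → ℝ} {v : Bool → ι → ℝ≥0}
    (hX : Measurable X) (hT : Measurable T) (hB : Measurable B) (he : ∀ s, Measurable (e s))
    (hg : ∀ s, Measurable (g s)) (hlaw : ∀ s, P.map (e s) = factGaussian 0 (v s))
    (hind : ∀ s, IndepFun (e s) (fun ω => ((X ω, T ω), B ω)) P) :
    HasCondDistrib (fun ω => g (T ω) (B ω) + e (T ω) ω) (fun ω => ((X ω, T ω), B ω))
      (noiseKernel g hg v) P := by
  set Z := fun ω => ((X ω, T ω), B ω) with hZdef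
  have hZ : Measurable Z := (hX.prodMk hT).prodMk hB
  have hgT : Measurable fun p : Bool × β => g p.1 p.2 := measurable_from_prod_countable_right hg
  have heT : Measurable fun p : Bool × Ω => e p.1 p.2 := measurable_from_prod_countable_right he
  have hY : Measurable fun ω => g (T ω) (B ω) + e (T ω) ω :=
    (hgT.comp (hT.prodMk hB)).add (heT.comp (hT.prodMk measurable_id))
  refine ⟨(hZ.prodMk hY).aemeasurable, ?_⟩
  ext S hS
  let U : Bool → Set ((𝒳 × Bool) × β) := fun s => {p | p.1.2 = s}
  have hU : ∀ s, MeasurableSet (U s) := fun s =>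
    (measurable_snd.comp measurable_fst) (measurableSet_singleton s)
  -- On `{T = s}` the factual noise is `e s`, so independence of each `e s` separately suffices; the
  -- two noises need not be independent of each other.
  have hpart : ∀ s, P.map (fun ω => (Z ω, g (T ω) (B ω) + e (T ω) ω)) (S ∩ Prod.fst ⁻¹' U s) =
      ∫⁻ z in U s, noiseKernel g hg v z (Prod.mk z ⁻¹' S) ∂P.map Z := fun s => by
    have hSU : MeasurableSet (S ∩ Prod.fst ⁻¹' U s) := hS.inter (measurable_fst (hU s))
    have h := map_prod_add_noise hZ (he s) ((hg s).comp measurable_snd) (hlaw s) (hind s) hSU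
    have hY' : Measurable fun ω => (Z ω, (g s ∘ Prod.snd) (Z ω) + e s ω) :=
      hZ.prodMk ((((hg s).comp measurable_snd).comp hZ).add (he s))
    rw [Measure.map_apply hY' hSU] at h
    rw [Measure.map_apply (hZ.prodMk hY) hSU, ← lintegral_indicator (hU s)]
    refine Eq.trans (congrArg P ?_) (h.trans (lintegral_congr fun z => ?_))
    · ext ω
      simp only [Set.mem_preimage, Set.mem_inter_iff, U, Set.mem_ofPred_eq, Z, Function.comp_apply]
      constructor <;> rintro ⟨h₁, rfl⟩ <;> exact ⟨h₁, rfl⟩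
    · by_cases hz : z ∈ U s
      · have hz' : z.1.2 = s := hz
        rw [Set.indicator_of_mem hz]
        subst hz'
        refine congrArg (factGaussian _ _) ?_
        ext y
        simp [U]
      · rw [Set.indicator_of_notMem hz]
        convert measure_empty (μ := factGaussian _ _)
        ext y
        simp [hz]
  have hsum : ∀ μ : Measure (((𝒳 × Bool) × β) × (ι → ℝ)),
      μ S = μ (S ∩ Prod.fst ⁻¹' U true) + μ (S ∩ Prod.fst ⁻¹' U false) := fun μ => by
    rw [← measure_inter_add_sdiff S (measurable_fst (hU true))]
    congr 2
    ext p
    simp [U]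
  rw [hsum, hpart, hpart, Measure.compProd_apply hS]
  have hc : U false = (U true)ᶜ := by ext p; simp [U]
  rw [hc, lintegral_add_compl _ (hU true)]

/-! ### Scores of additive noise models -/

/-- The event `{T = s}` belongs to the σ-algebra of `(T, B)`, of which `e` is independent. -/
theorem indepFun_cond_of_prodMk {Ω α β : Type*} [MeasurableSpace Ω] [MeasurableSpace α]
    [MeasurableSpace β] {P : Measure Ω} [IsProbabilityMeasure P] {e : Ω → α} {T : Ω → Bool}
    {B : Ω → β} (hT : Measurable T) (he : Measurable e)
    (hind : IndepFun e (fun ω => (T ω, B ω)) P) {s : Bool} (hs : P (T ⁻¹' {s}) ≠ 0) :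
    IndepFun e B (cond P (T ⁻¹' {s})) ∧ (cond P (T ⁻¹' {s})).map e = P.map e := by
  have hTs : MeasurableSet (T ⁻¹' {s}) := hT (measurableSet_singleton s)
  have hi := indepFun_iff_measure_inter_preimage_eq_mul.1 hind
  have key : ∀ A C, MeasurableSet A → MeasurableSet C →
      cond P (T ⁻¹' {s}) (e ⁻¹' A ∩ B ⁻¹' C) = P (e ⁻¹' A) * cond P (T ⁻¹' {s}) (B ⁻¹' C) := by
    intro A C hA hC
    have h := hi A ({s} ×ˢ C) hA ((measurableSet_singleton s).prod hC)
    have e₁ : (fun ω => (T ω, B ω)) ⁻¹' ({s} ×ˢ C) = T ⁻¹' {s} ∩ B ⁻¹' C := rfl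
    rw [cond_apply hTs, cond_apply hTs, ← mul_assoc, mul_comm (P _), mul_assoc, ← e₁, ← h, e₁,
      Set.inter_left_comm]
  have : IsProbabilityMeasure (cond P (T ⁻¹' {s})) := cond_isProbabilityMeasure hs
  have he' : ∀ A, MeasurableSet A → cond P (T ⁻¹' {s}) (e ⁻¹' A) = P (e ⁻¹' A) := fun A hA => by
    simpa using key A Set.univ hA MeasurableSet.univ
  refine ⟨indepFun_iff_measure_inter_preimage_eq_mul.2 fun A C hA hC => ?_, ?_⟩
  · rw [key A C hA hC, he' A hA]
  · ext A hA
    rw [Measure.map_apply he hA, Measure.map_apply he hA, he' A hA]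

theorem condExp_comp_add_noise {Ω γ E : Type*} [MeasurableSpace Ω]
    [NormedAddCommGroup E] [NormedSpace ℝ E] [CompleteSpace E] [MeasurableSpace E] [BorelSpace E]
    [SecondCountableTopology E] {P : Measure Ω} [IsFiniteMeasure P] [MeasurableSpace γ]
    {Z : Ω → γ} {W : Ω → E} {e : Ω → E} (hZ : Measurable Z) (he : Measurable e)
    (hW : Integrable W P) (hei : Integrable e P) (hmean : ∫ ω, e ω ∂P = 0) (hind : IndepFun e Z P) :
    condExp (MeasurableSpace.comap Z inferInstance) P (fun ω => W ω + e ω) =ᵐ[P]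
      condExp (MeasurableSpace.comap Z inferInstance) P W := by
  have h₁ := condExp_add hW hei (MeasurableSpace.comap Z inferInstance)
  have h₂ : condExp (MeasurableSpace.comap Z inferInstance) P e =ᵐ[P] fun _ => ∫ ω, e ω ∂P :=
    condExp_indep_eq he.comap_le hZ.comap_le (comap_measurable e).stronglyMeasurable hind
  filter_upwards [h₁, h₂] with ω h₁ h₂
  rw [Pi.add_apply, h₂, hmean, add_zero] at h₁
  exact h₁

/-- A random vector is a B-score for outcomes which are functions of it plus centred noise that
is independent of it, of the covariate and of the treatment. -/
theorem isBScore_of_additive_noise {Ω 𝒳 : Type*} [MeasurableSpace Ω] [MeasurableSpace 𝒳]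
    {P : Measure Ω} [IsProbabilityMeasure P] {n d : ℕ} {X : Ω → 𝒳} {T : Ω → Bool}
    {B : Ω → Fin n → ℝ} {e : Bool → Ω → Fin d → ℝ} {F : Bool → (Fin n → ℝ) → (Fin d → ℝ)}
    (hX : Measurable X) (hT : Measurable T) (hB : Measurable B) (he : ∀ s, Measurable (e s))
    (hF : ∀ s, Measurable (F s)) (hFi : ∀ s, Integrable (fun ω => F s (B ω)) P)
    (hei : ∀ s, Integrable (e s) P) (hmean : ∀ s, ∫ ω, e s ω ∂P = 0)
    (hind : ∀ s, IndepFun (e s) (fun ω => ((X ω, T ω), B ω)) P) :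
    IsBScore P X T (fun s ω => F s (B ω) + e s ω) B := by
  refine fun s => ⟨(hFi s).add (hei s), F s, hF s, ?_, ?_⟩
  · have hZ : Measurable fun ω => (B ω, X ω) := hB.prodMk hX
    have hi : IndepFun (e s) (fun ω => (B ω, X ω)) P :=
      (hind s).comp measurable_id
        (ψ := fun p : (𝒳 × Bool) × (Fin n → ℝ) => (p.2, p.1.1)) (by fun_prop)
    refine (condExp_comp_add_noise hZ (he s) (hFi s) (hei s)
      (hmean s) hi).trans ?_
    rw [condExp_of_stronglyMeasurable hZ.comap_le _ (hFi s)]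
    have hFm : Measurable fun p : (Fin n → ℝ) × 𝒳 => F s p.1 := (hF s).comp measurable_fst
    exact (hFm.comp (comap_measurable fun ω => (B ω, X ω))).stronglyMeasurable
  -- For a treatment of probability zero the conditioned measure is `0`, and the claim is vacuous.
  · by_cases hs : P (T ⁻¹' {s}) = 0
    · rw [cond_eq_zero_of_meas_eq_zero hs]; simp [Filter.EventuallyEq]
    have : IsProbabilityMeasure (cond P (T ⁻¹' {s})) := cond_isProbabilityMeasure hs
    have hi : IndepFun (e s) (fun ω => (T ω, B ω)) P :=
      (hind s).comp measurable_id
        (ψ := fun p : (𝒳 × Bool) × (Fin n → ℝ) => (p.1.2, p.2)) (by fun_prop)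
    obtain ⟨hi', hlaw⟩ := indepFun_cond_of_prodMk hT (he s) hi hs
    have hci : ∀ {g : Ω → Fin d → ℝ}, Integrable g P → Integrable g (cond P (T ⁻¹' {s})) :=
      fun hg => hg.restrict.smul_measure (ENNReal.inv_ne_top.2 hs)
    have hm : ∫ ω, e s ω ∂cond P (T ⁻¹' {s}) = 0 := by
      have hmap := fun μ : Measure Ω => integral_map (μ := μ) (f := fun x => x)
        (he s).aemeasurable measurable_id.aestronglyMeasurable
      rw [← hmap, hlaw, hmap, hmean]
    refine (condExp_comp_add_noise hB (he s) (hci (hFi s)) (hci (hei s)) hm hi').trans ?_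
    rw [condExp_of_stronglyMeasurable hB.comap_le _ (hci (hFi s))]
    exact ((hF s).comp (comap_measurable _)).stronglyMeasurable

/-! ### The encoder -/

namespace TrueProcess

variable {Ω : Type*} [MeasurableSpace Ω] {P : Measure Ω} {𝒳 𝒰 ℰ : Type*}
  [MeasurableSpace 𝒳] [MeasurableSpace 𝒰] [MeasurableSpace ℰ] {n d : ℕ}
  (M : TrueProcess P 𝒳 𝒰 ℰ n d)

theorem measurable_score : Measurable M.score :=
  M.measurable_scoreFun.comp (M.measurable_x.prodMk (M.measurable_u.prodMk M.measurable_eb))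

theorem measurable_y : Measurable M.y := by
  have h : Measurable fun p : Bool × Ω => M.potential p.1 p.2 :=
    measurable_from_prod_countable_right fun s =>
      ((M.measurable_f s).comp M.measurable_score).add (M.measurable_ea s)
  exact h.comp (M.measurable_t.prodMk measurable_id)

theorem measurable_obs : Measurable M.obs :=
  M.measurable_x.prodMk (M.measurable_y.prodMk M.measurable_t)

theorem indepFun_ea_score {β : Type*} [MeasurableSpace β] {g : (Fin n → ℝ) → β}
    (hg : Measurable g) (s : Bool) :
    IndepFun (M.ea s) (fun ω => ((M.x ω, M.t ω), g (M.score ω))) P := by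
  have := M.measurable_scoreFun
  exact (M.indep_ea s).comp measurable_id
    (ψ := fun p : 𝒳 × Bool × 𝒰 × ℰ => ((p.1, p.2.1), g (M.scoreFun (p.1, p.2.2.1, p.2.2.2))))
    (by fun_prop)

theorem integrable_ea (s : Bool) : Integrable (M.ea s) P := by
  have h := integrable_id_factGaussian 0 (M.noiseVar s)
  rw [← M.law_ea s] at h
  exact h.comp_measurable (M.measurable_ea s)

theorem integral_ea (s : Bool) : ∫ ω, M.ea s ω ∂P = 0 := by
  have h := integral_id_factGaussian 0 (M.noiseVar s)
  rw [← M.law_ea s] at h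
  exact (integral_map (f := fun x => x) (M.measurable_ea s).aemeasurable
    measurable_id.aestronglyMeasurable).symm.trans h

theorem integrable_outcome {s : Bool} (hint : Integrable (M.potential s) P) :
    Integrable (fun ω => M.f s (M.score ω)) P := by
  refine (hint.sub (M.integrable_ea s)).congr (ae_of_all _ fun ω => ?_)
  simp [potential]

/-- If the outcome functions are those of `θ` after a measurable change `ψ` of the score, and `θ`
reproduces the conditional distribution of the outcome, then a consistent encoder for `θ` is the
conditional distribution of the transformed score given the observation. -/
theorem hasCondDistrib_encoder [IsProbabilityMeasure P] {pstar : Kernel (𝒳 × Bool) (Fin d → ℝ)}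
    [IsMarkovKernel pstar] (hpstar : HasCondDistrib M.y (fun ω => (M.x ω, M.t ω)) pstar P)
    {θ : Params 𝒳 n d} (hθ : θ.Admissible)
    (hev : ∀ t x, θ.evidence M.noiseVar t x = pstar (x, t))
    {ψ : (Fin n → ℝ) → (Fin n → ℝ)} (hψ : Measurable ψ) (hf : ∀ s b, θ.f s (ψ b) = M.f s b)
    {q : Kernel (𝒳 × (Fin d → ℝ) × Bool) (Fin n → ℝ)} [IsMarkovKernel q]
    (hq : EncoderConsistent θ M.noiseVar q) :
    HasCondDistrib (fun ω => ψ (M.score ω)) M.obs q P := by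
  set W : Ω → Fin n → ℝ := fun ω => ψ (M.score ω) with hWdef
  have hW : Measurable W := hψ.comp M.measurable_score
  set XT : Ω → 𝒳 × Bool := fun ω => (M.x ω, M.t ω) with hXTdef
  have hXT : Measurable XT := M.measurable_x.prodMk M.measurable_t
  set D : Kernel ((𝒳 × Bool) × (Fin n → ℝ)) (Fin d → ℝ) :=
    noiseKernel θ.f θ.measurable_f M.noiseVar with hD
  set κ := condDistrib W XT P with hκ
  have hWκ : HasCondDistrib W XT κ P :=
    ⟨(hXT.prodMk hW).aemeasurable, (compProd_map_condDistrib hW.aemeasurable).symm⟩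
  have hyD : HasCondDistrib M.y (fun ω => (XT ω, W ω)) D P := by
    have h := hasCondDistrib_factual M.measurable_x M.measurable_t hW M.measurable_ea
      θ.measurable_f M.law_ea fun s => M.indepFun_ea_score hψ s
    have hy : (fun ω => θ.f (M.t ω) (W ω) + M.ea (M.t ω) ω) = M.y :=
      funext fun ω => by simp [y, potential, W, hf]
    rwa [hy] at h
  have hjoint : HasCondDistrib (fun ω => (W ω, M.y ω)) XT (κ ⊗ₖ D) P := by
    refine ⟨(hXT.prodMk (hW.prodMk M.measurable_y)).aemeasurable, ?_⟩
    rw [← Measure.compProd_assoc', ← hWκ.map_eq, ← hyD.map_eq,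
      Measure.map_map (by fun_prop) ((hXT.prodMk hW).prodMk M.measurable_y)]
    rfl
  have hsec : ∀ (μ : Measure (Fin n → ℝ)) [IsProbabilityMeasure μ] (a : 𝒳 × Bool), κ a = μ →
      (κ ⊗ₖ D) a = μ ⊗ₘ θ.decoder M.noiseVar a.2 := fun μ _ a ha => by
    ext S hS
    rw [Kernel.compProd_apply hS, Measure.compProd_apply hS, ha]
    rfl
  -- The law of `y` given `(x, t)`, computed through `W`, must be the evidence. Removing the noise
  -- and pulling back along the injective `θ.f` identifies the law of `W` with the prior.
  have hκprior : ∀ᵐ a ∂P.map XT, κ a = θ.prior a.2 a.1 := by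
    filter_upwards [hasCondDistrib_ae_unique hjoint.snd hpstar] with a ha
    rw [Kernel.snd_apply, hsec (κ a) a rfl, ← hev, θ.evidence_eq_conv] at ha
    have : (κ a ⊗ₘ θ.decoder M.noiseVar a.2).map Prod.snd =
        (κ a).map (θ.f a.2) ∗ factGaussian 0 (M.noiseVar a.2) := by
      rw [conv_factGaussian_eq_bind (θ.measurable_f a.2)]
      exact Measure.snd_compProd _ _
    rw [this] at ha
    have ha := congrArg (Measure.comap (θ.f a.2)) (conv_factGaussian_injective ha)
    rwa [(hθ.measurableEmbedding a.2).comap_map, (hθ.measurableEmbedding a.2).comap_map] at ha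
  let r : (𝒳 × Bool) × (Fin d → ℝ) → 𝒳 × (Fin d → ℝ) × Bool := fun p => (p.1.1, p.2, p.1.2)
  have hr : Measurable r := by fun_prop
  -- Bayes: prior times decoder, with factors swapped, is evidence times posterior. Consistency of
  -- `q` only almost everywhere in `y` is enough here.
  have hswap : (κ ⊗ₖ D).map Prod.swap =ᵐ[P.map XT] pstar ⊗ₖ q.comap r hr := by
    filter_upwards [hκprior] with a ha
    rw [Kernel.map_apply _ measurable_swap, hsec _ a ha,
      ← compProd_posterior_eq_map_swap]
    have : IsMarkovKernel (θ.posteriorKernel M.noiseVar a.2 a.1) := by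
      unfold Params.posteriorKernel; infer_instance
    have hcongr : θ.evidence M.noiseVar a.2 a.1 ⊗ₘ θ.posteriorKernel M.noiseVar a.2 a.1 =
        θ.evidence M.noiseVar a.2 a.1 ⊗ₘ (q.comap r hr).comap (Prod.mk a) measurable_prodMk_left :=
      Measure.compProd_congr ((hq a.2 a.1).mono fun y hy => hy.symm)
    refine hcongr.trans ?_
    rw [hev]
    ext S hS
    rw [Kernel.compProd_apply hS, Measure.compProd_apply hS]
    rfl
  have hfin := hasCondDistrib_congr_kernel (hjoint.comp_left measurable_swap) hswap
  exact (HasCondDistrib.of_compProd (X := XT) (Y := M.y) (Z := W) hfin).comp_right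

end TrueProcess

/-- Consistency of the decoder at a score which has the encoder as its conditional distribution. -/
theorem condExp_potential_eq_condExp_encoder {Ω : Type*} [MeasurableSpace Ω] {P : Measure Ω}
    [IsProbabilityMeasure P] {𝒳 𝒰 ℰ : Type*} [MeasurableSpace 𝒳] [MeasurableSpace 𝒰]
    [MeasurableSpace ℰ] {n d : ℕ} (M : TrueProcess P 𝒳 𝒰 ℰ n d) {s : Bool}
    (hint : Integrable (M.potential s) P) {W : Ω → Fin n → ℝ} (hW : Measurable W)
    {g : (Fin n → ℝ) → (Fin d → ℝ)} (hg : Measurable g) (hgW : ∀ ω, g (W ω) = M.f s (M.score ω))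
    {q : Kernel (𝒳 × (Fin d → ℝ) × Bool) (Fin n → ℝ)} [IsMarkovKernel q]
    (hq : HasCondDistrib W M.obs q P) :
    M.μ s =ᵐ[P] condExp (MeasurableSpace.comap M.x inferInstance) P
      (fun ω => ∫ z, g z ∂(q (M.obs ω))) := by
  have hgi : Integrable (fun ω => g (W ω)) P := by
    simpa only [hgW] using M.integrable_outcome hint
  have h₁ : M.μ s =ᵐ[P]
      condExp (MeasurableSpace.comap M.x inferInstance) P (fun ω => g (W ω)) := by
    have hi : IndepFun (M.ea s) M.x P :=
      (M.indep_ea s).comp measurable_id measurable_fst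
    have h := condExp_comp_add_noise M.measurable_x (M.measurable_ea s) hgi
      (M.integrable_ea s) (M.integral_ea s) hi
    simp only [hgW] at h ⊢
    exact h
  have h₂ : condExp (MeasurableSpace.comap M.obs inferInstance) P (fun ω => g (W ω)) =ᵐ[P]
      fun ω => ∫ z, g z ∂(q (M.obs ω)) := by
    refine (condExp_ae_eq_integral_condDistrib M.measurable_obs hW.aemeasurable
      hg.stronglyMeasurable hgi).trans ?_
    have := ae_of_ae_map M.measurable_obs.aemeasurable
      (condDistrib_ae_eq_of_measure_eq_compProd M.obs hW.aemeasurable hq.map_eq)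
    filter_upwards [this] with ω hω
    rw [hω]
  have hle : MeasurableSpace.comap M.x inferInstance ≤ MeasurableSpace.comap M.obs inferInstance :=
    (measurable_fst.comp (comap_measurable M.obs)).comap_le
  exact h₁.trans ((condExp_condExp_of_le hle M.measurable_obs.comap_le).symm.trans
    (condExp_congr_ae h₂))

/-- The fresh noise is independent of `(x, y, t, z)` by construction, so only integrability of the
outcome functions under the encoder's law is at stake. -/
theorem encoderIsBScore_of_integrable {Ω : Type*} [MeasurableSpace Ω] {P : Measure Ω}
    [IsProbabilityMeasure P] {𝒳 𝒰 ℰ : Type*} [MeasurableSpace 𝒳] [MeasurableSpace 𝒰]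
    [MeasurableSpace ℰ] {n d : ℕ} (M : TrueProcess P 𝒳 𝒰 ℰ n d) {θ : Params 𝒳 n d}
    {q : Kernel (𝒳 × (Fin d → ℝ) × Bool) (Fin n → ℝ)} [IsMarkovKernel q]
    (hint : ∀ s, Integrable (fun p => θ.f s p.2) (encodedLaw M q)) : EncoderIsBScore M θ q := by
  have : IsProbabilityMeasure (P.map M.obs) :=
    Measure.isProbabilityMeasure_map M.measurable_obs.aemeasurable
  have : IsProbabilityMeasure (encodedLaw M q) := by unfold encodedLaw; infer_instance
  have : IsProbabilityMeasure (encodedNoiseLaw M q) := by unfold encodedNoiseLaw; infer_instance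
  let ν : Measure (Bool → Fin d → ℝ) := Measure.pi fun s => factGaussian 0 (M.noiseVar s)
  have hfst : (encodedNoiseLaw M q).map Prod.fst = encodedLaw M q := Measure.fst_prod
  have hnoise : ∀ s, (encodedNoiseLaw M q).map (fun p => p.2 s) =
      factGaussian 0 (M.noiseVar s) := fun s => by
    have : (encodedNoiseLaw M q).map (fun p => p.2 s) =
        ((encodedNoiseLaw M q).map Prod.snd).map (fun e => e s) :=
      (Measure.map_map (measurable_pi_apply s) measurable_snd).symm
    rw [this, show (encodedNoiseLaw M q).map Prod.snd = ν from Measure.snd_prod]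
    simp [ν, Measure.pi_map_eval]
  have hx : Measurable fun p : ((𝒳 × (Fin d → ℝ) × Bool) × (Fin n → ℝ)) ×
      (Bool → Fin d → ℝ) => p.1.1.1 := by fun_prop
  have ht : Measurable fun p : ((𝒳 × (Fin d → ℝ) × Bool) × (Fin n → ℝ)) ×
      (Bool → Fin d → ℝ) => p.1.1.2.2 := by fun_prop
  have hz : Measurable fun p : ((𝒳 × (Fin d → ℝ) × Bool) × (Fin n → ℝ)) ×
      (Bool → Fin d → ℝ) => p.1.2 := by fun_prop
  have hms : ∀ s, Measurable fun p : ((𝒳 × (Fin d → ℝ) × Bool) × (Fin n → ℝ)) ×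
      (Bool → Fin d → ℝ) => p.2 s := fun s => by fun_prop
  refine isBScore_of_additive_noise (F := θ.f)
    (e := fun s (p : ((𝒳 × (Fin d → ℝ) × Bool) × (Fin n → ℝ)) × (Bool → Fin d → ℝ)) => p.2 s)
    hx ht hz hms θ.measurable_f (fun s => ?_) (fun s => ?_)
    (fun s => ?_) (fun s => ?_)
  · have h := hint s
    rw [← hfst] at h
    exact h.comp_measurable measurable_fst
  · have h := integrable_id_factGaussian 0 (M.noiseVar s)
    rw [← hnoise s] at h
    exact h.comp_measurable (hms s)
  · have h := integral_id_factGaussian 0 (M.noiseVar s)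
    rw [← hnoise s] at h
    exact (integral_map (f := fun x => x) (hms s).aemeasurable
      measurable_id.aestronglyMeasurable).symm.trans h
  · exact (indepFun_prod (μ := encodedLaw M q) (ν := ν)
      (X := fun p => ((p.1.1, p.1.2.2), p.2)) (Y := fun e => e s) (by fun_prop)
      (by fun_prop)).symm

end IntactVAE

end

/-! ### The main theorem -/

theorem mainTheorem5 {Ω 𝒳 𝒰 ℰ : Type*} [MeasurableSpace Ω] [MeasurableSpace 𝒳]
    [MeasurableSpace 𝒰] [MeasurableSpace ℰ] (P : Measure Ω) [IsProbabilityMeasure P] {n d : ℕ}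
    (M : IntactVAE.TrueProcess P 𝒳 𝒰 ℰ n d)
    (hint : ∀ s, Integrable (M.potential s) P)
    (pstar : Kernel (𝒳 × Bool) (Fin d → ℝ)) [IsMarkovKernel pstar]
    (hpstar : HasCondDistrib M.y (fun ω => (M.x ω, M.t ω)) pstar P) :
    -- balanced estimation under general balancing
    (∀ Θ : Set (IntactVAE.Params 𝒳 n d), (∀ θ ∈ Θ, θ.Admissible) →
      (∃ θs ∈ IntactVAE.optimalParams Θ M.noiseVar pstar, θs.f = M.f) →
      (∃ (x₀ : 𝒳) (x : Fin n ⊕ Fin n → 𝒳),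
        IntactVAE.GeneralBalancing (IntactVAE.optimalParams Θ M.noiseVar pstar) x₀ x) →
      ∀ θ' ∈ IntactVAE.optimalParams Θ M.noiseVar pstar,
      ∀ (q : Kernel (𝒳 × (Fin d → ℝ) × Bool) (Fin n → ℝ)) [IsMarkovKernel q],
        IntactVAE.EncoderConsistent θ' M.noiseVar q →
        (∃ 𝒜 : (Fin n → ℝ) ≃ᵃ[ℝ] (Fin n → ℝ), IntactVAE.IsCoordinatewise 𝒜 ∧
          (∀ t, θ'.f t = M.f t ∘ 𝒜) ∧
          HasCondDistrib (fun ω => 𝒜.symm (M.score ω)) M.obs q P ∧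
          IntactVAE.IsBScore P M.x M.t M.potential (fun ω => 𝒜.symm (M.score ω))) ∧
        IntactVAE.EncoderIsBScore M θ' q ∧
        ∀ s, Integrable (fun p => θ'.f s p.2) (IntactVAE.encodedLaw M q) ∧
          M.μ s =ᵐ[P] condExp (MeasurableSpace.comap M.x inferInstance) P
            (fun ω => ∫ z, θ'.f s z ∂(q (M.obs ω)))) ∧
    -- general balancing is necessary and sufficient for the two affine maps to coincide
    (∀ θ θ' : IntactVAE.Params 𝒳 n d, θ.Admissible → θ'.Admissible →
      (∀ t x, θ.evidence M.noiseVar t x = θ'.evidence M.noiseVar t x) →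
      ∀ (x₀ : 𝒳) (x : Fin n ⊕ Fin n → 𝒳), (∀ t, IsUnit (θ.L t x₀ x)) →
      ∃ 𝒜 : Bool → ((Fin n → ℝ) ≃ᵃ[ℝ] (Fin n → ℝ)),
        (∀ t, IntactVAE.IsCoordinatewise (𝒜 t) ∧ θ'.f t = θ.f t ∘ 𝒜 t) ∧
        (IntactVAE.GeneralBalancing {θ, θ'} x₀ x ↔ 𝒜 false = 𝒜 true)) := by
  refine ⟨fun Θ hΘ hs hbal θ' hθ' q _ hq => ?_, fun θ θ' hθ hθ' h x₀ x hL =>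
    IntactVAE.identifiability θ θ' hθ hθ' h x₀ x hL⟩
  obtain ⟨θs, hθs, hfs⟩ := hs
  obtain ⟨x₀, x, C, δ, hC, hS⟩ := hbal
  have hL : ∀ t, IsUnit (θs.L t x₀ x) := by
    have h := hS θs hθs
    rintro (_ | _)
    · exact h.isUnit_L
    · have hdet := (Matrix.isUnit_iff_isUnit_det _).1 h.isUnit_L
      rw [show θs.L true x₀ x = θs.L false x₀ x * C by
        rw [← h.L_eq, ← Matrix.mul_assoc, Matrix.mul_nonsing_inv _ hdet, Matrix.one_mul]]
      exact h.isUnit_L.mul hC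
  obtain ⟨𝒜, h𝒜, hiff⟩ := IntactVAE.identifiability θs θ' (hΘ θs hθs.1) (hΘ θ' hθ'.1)
    (fun t x => (hθs.2 t x).trans (hθ'.2 t x).symm) x₀ x hL
  -- Balancing of the whole optimal set restricts to the pair `{θs, θ'}`.
  have heq : 𝒜 false = 𝒜 true := hiff.1 ⟨C, δ, hC, by
    rintro η (rfl | rfl)
    exacts [hS _ hθs, hS _ hθ']⟩
  have hf : ∀ t, θ'.f t = M.f t ∘ 𝒜 true := by
    rintro (_ | _)
    · rw [← heq, (h𝒜 false).2, hfs]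
    · rw [(h𝒜 true).2, hfs]
  set A := 𝒜 true
  have hAm : Measurable A.symm :=
    (AffineMap.continuous_of_finiteDimensional A.symm.toAffineMap).measurable
  have hW : Measurable fun ω => A.symm (M.score ω) := hAm.comp M.measurable_score
  have hfA : ∀ s b, θ'.f s (A.symm b) = M.f s b := fun s b => by simp [hf]
  have hlaw : HasCondDistrib (fun ω => A.symm (M.score ω)) M.obs q P :=
    M.hasCondDistrib_encoder hpstar (hΘ θ' hθ'.1) hθ'.2 hAm hfA hq
  have hint' : ∀ s, Integrable (fun ω => θ'.f s (A.symm (M.score ω))) P := fun s => by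
    simpa only [hfA] using M.integrable_outcome (hint s)
  -- The encoded law is the law of `(obs, 𝒜⁻¹(B*))`, so integrability is inherited from the true
  -- outcomes.
  have henc : ∀ s, Integrable (fun p => θ'.f s p.2) (IntactVAE.encodedLaw M q) := fun s => by
    rw [IntactVAE.encodedLaw, ← hlaw.map_eq]
    exact (integrable_map_measure ((θ'.measurable_f s).comp measurable_snd).aestronglyMeasurable
      hlaw.aemeasurable).2 (hint' s)
  refine ⟨⟨A, (h𝒜 true).1, hf, hlaw, ?_⟩, IntactVAE.encoderIsBScore_of_integrable M henc,
    fun s => ⟨henc s, IntactVAE.condExp_potential_eq_condExp_encoder M (hint s) hW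
      (θ'.measurable_f s) (fun ω => hfA s _) hlaw⟩⟩
  have h := IntactVAE.isBScore_of_additive_noise M.measurable_x M.measurable_t hW M.measurable_ea
    θ'.measurable_f hint' M.integrable_ea M.integral_ea fun s => M.indepFun_ea_score hAm s
  simp only [hfA] at h
  exact h
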